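/- Let $M$ be a complex manifold of dimension $n$ with a (smooth) Hermitian metric $\omega$, and let $\Omega\subset\subset M$ be a relatively compact domain with $C^2$ boundary $b\Omega$. Write $|X|$ for the length of a $(1,0)$-vector $X$ with respect to $\omega$, $\partial\bar\partial u(X,\overline X)=\sum_{j,k}\frac{\partial^2u}{\partial z_j\partial\bar z_k}X_j\overline{X_k}$ for the complex Hessian of a real function $u$, and $\delta$ for the geodesic distance to $b\Omega$. A *defining function* of $\Omega$ is a continuous function $r:M\to\mathbb R$, of class $C^2$ near $b\Omega$, with $r<0$ on $\Omega$, $r>0$ on $M\setminus\overline\Omega$ and $C_1\delta\le|r|\le C_2\delta$ near $b\Omega$ for some constants $C_1,C_2>0$; it is *normalized* if $|r(z)|/\delta(z)\to1$ as $z\to b\Omega$. A number $\eta\in(0,1]$ is a *Diederich–Fornæss exponent* of $r$ if $\partial\bar\partial(-(-r)^\eta)\ge0$ on $U\cap\Omega$ for some neighbourhood $U$ of $b\Omega$. $I(r)$ is the supremum of the exponents of $r$ (with $I(r)=0$ if there are none), and the *Diederich–Fornæss index* $I(\Omega)$ is the supremum of $I(r)$ over all defining functions $r$ of $\Omega$.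 Let $r$ be a normalized defining function of $\Omega$, and let $K$ and $K_1>1$ be constants. Suppose that $r$ satisfies the Oka condition $$\partial\bar\partial(-\log(-r))\ge K\omega\quad\text{on }U\cap\Omega$$ for some neighbourhood $U$ of $b\Omega$. Let $W$ be the set of weakly pseudoconvex points of $b\Omega$, that is, the points at which the Levi form ($\partial\bar\partial r$ restricted to the $(1,0)$-vectors $X$ with $Xr=0$) is positive semidefinite but not positive definite. Suppose further that there is a neighbourhood $V$ of $W$ such that $$K|X_\tau|^2\le\frac{\partial\bar\partial r(X_\tau,\overline{X}_\tau)}{-r}\le KK_1|X_\tau|^2$$ for all $z\in V\cap\Omega$ and all complex tangential vectors $X_\tau$ at $z$, that is, all $(1,0)$-vectors $X_\tau$ at $z$ with $X_\tau r=0$. Then $$I(\Omega)\ge\max\left\{\min\left\{\frac1{8(K_1-1)},\frac12\right\},\,3-2K_1\right\}.$$ -/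

import Mathlib

open Set Filter Topology Manifold Bundle
open scoped ContDiff

/-- The real smooth (indeed analytic) manifold underlying a complex manifold, with the same atlas. -/
instance realManifoldOfComplex {E : Type*} [NormedAddCommGroup E] [NormedSpace ℂ E]
    {M : Type*} [TopologicalSpace M] [ChartedSpace E M] [IsManifold 𝓘(ℂ, E) ω M] : IsManifold 𝓘(ℝ, E) ω M := by
  refine isManifold_of_contDiffOn _ _ _ fun e e' he he' => ?_
  have h := (contDiffGroupoid ω 𝓘(ℂ, E)).compatible (H := E) he he'
  rw [contDiffGroupoid, mem_groupoid_of_pregroupoid] at h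
  exact h.1.restrict_scalars ℝ

noncomputable section

section Calculus

variable {E : Type*} [NormedAddCommGroup E] [NormedSpace ℂ E]
  {M : Type*} [TopologicalSpace M] [ChartedSpace E M]

/-- The real tangent space of `M` at `x`. In Mathlib a tangent vector at `x` is its coordinate vector,
in the model space `E ≅ ℂⁿ`, with respect to the preferred holomorphic chart `chartAt E x`.

Throughout, a `(1,0)`-vector `X` at `x` is represented by the real tangent vector `ξ` with
`X = (ξ - √-1 J ξ) / √2`. This is a complex linear isomorphism of `(T_x M, J)` onto `T_x^{1,0} M`. -/
abbrev TanSp (x : M) := TangentSpace 𝓘(ℝ, E) x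

/-- The complex structure `J`: multiplication by `√-1` in holomorphic coordinates. -/
def cplxJ (x : M) (ξ : TanSp (E := E) x) : TanSp (E := E) x :=
  let v : E := ξ
  (Complex.I • v : E)

/-- `u` read in the preferred holomorphic chart at `x`. -/
def chartRep (u : M → ℝ) (x : M) : E → ℝ := u ∘ (chartAt E x).symm

/-- `X u = ∂u(X)` for the `(1,0)`-vector `X = (ξ - √-1 J ξ) / √2` at `x`. -/
def delForm (u : M → ℝ) (x : M) (ξ : TanSp (E := E) x) : ℂ :=
  ((fderiv ℝ (chartRep u x) (chartAt E x x) ξ : ℝ) -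
    Complex.I * (fderiv ℝ (chartRep u x) (chartAt E x x) (cplxJ x ξ) : ℝ)) / (√2 : ℝ)

/-- The complex Hessian `∂∂̄u(X, X̄) = ∑ u_{j k̄} X_j X̄_k` for the `(1,0)`-vector
`X = (ξ - √-1 J ξ) / √2 = ∑ X_j ∂/∂z_j` at `x`. In holomorphic coordinates `X_j = √2 ξ_j` and
`4 ∑ u_{j k̄} ξ_j ξ̄_k = D²u(ξ, ξ) + D²u(Jξ, Jξ)`. -/
def cplxHessian (u : M → ℝ) (x : M) (ξ : TanSp (E := E) x) : ℝ :=
  (iteratedFDeriv ℝ 2 (chartRep u x) (chartAt E x x) (fun _ => ξ) +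
    iteratedFDeriv ℝ 2 (chartRep u x) (chartAt E x x) (fun _ => cplxJ x ξ)) / 2

variable (E)

/-- The open set `Ω` has `C²` boundary: near every boundary point it is the sublevel set of a
`C²` function with nonvanishing differential. -/
def HasC2Boundary (Ω : Set M) : Prop :=
  ∀ p ∈ frontier Ω, ∃ ρ : M → ℝ, ContMDiffAt 𝓘(ℝ, E) 𝓘(ℝ, ℝ) 2 ρ p ∧
    mfderiv 𝓘(ℝ, E) 𝓘(ℝ, ℝ) ρ p ≠ 0 ∧ ∀ᶠ z in 𝓝 p, (z ∈ Ω ↔ ρ z < 0)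

/-- The weakly pseudoconvex boundary points of `Ω`, for a defining function `r` of `Ω`: the Levi form,
that is `∂∂̄r` on the complex tangent space `{X | X r = 0}` of the boundary, is positive semidefinite
but not positive definite. -/
def weaklyPseudoconvexPoints (Ω : Set M) (r : M → ℝ) : Set M :=
  {z | z ∈ frontier Ω ∧
    (∀ ξ : TanSp (E := E) z, delForm r z ξ = 0 → 0 ≤ cplxHessian r z ξ) ∧
    ∃ ξ : TanSp (E := E) z, ξ ≠ 0 ∧ delForm r z ξ = 0 ∧ cplxHessian r z ξ = 0}

/-- `η` is a Diederich-Fornæss exponent of the defining function `r` of `Ω`: `0 < η ≤ 1` and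
`∂∂̄(-(-r)^η) ≥ 0` on `U ∩ Ω` for some neighbourhood `U` of the boundary. -/
def IsDFExponent (Ω : Set M) (r : M → ℝ) (η : ℝ) : Prop :=
  0 < η ∧ η ≤ 1 ∧ ∀ᶠ z in 𝓝ˢ (frontier Ω), z ∈ Ω →
    ∀ ξ : TanSp (E := E) z, 0 ≤ cplxHessian (fun w => -(-r w) ^ η) z ξ

/-- The Diederich-Fornæss index `I(r)` of a defining function (`0` if there is no exponent). -/
def dfIndexOf (Ω : Set M) (r : M → ℝ) : ℝ := sSup {η | IsDFExponent E Ω r η}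

end Calculus

section Metric

variable {E : Type*} [NormedAddCommGroup E] [NormedSpace ℂ E]
  {M : Type*} [EMetricSpace M] [ChartedSpace E M]

/-- Distance to the boundary of `Ω` (finite near the boundary). -/
def bdryDist (Ω : Set M) (z : M) : ℝ := (Metric.infEDist z (frontier Ω)).toReal

/-- The squared length `|X|²` of the `(1,0)`-vector `X = (ξ - √-1 J ξ) / √2`, which for a Hermitian
metric equals the squared length of `ξ`. -/
def sqLength [RiemannianBundle (fun x : M => TangentSpace 𝓘(ℝ, E) x)]
    (x : M) (ξ : TanSp (E := E) x) : ℝ := inner ℝ ξ ξ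

variable (E)

/-- Defining functions of `Ω`, of class `C²` near the boundary. -/
structure IsDefiningFunction (Ω : Set M) (r : M → ℝ) : Prop where
  continuous : Continuous r
  neg : ∀ z ∈ Ω, r z < 0
  pos : ∀ z, z ∉ closure Ω → 0 < r z
  comparable : ∃ C₁ C₂ : ℝ, 0 < C₁ ∧ 0 < C₂ ∧ ∀ᶠ z in 𝓝ˢ (frontier Ω),
    C₁ * bdryDist Ω z ≤ |r z| ∧ |r z| ≤ C₂ * bdryDist Ω z
  contMDiffAt : ∀ᶠ z in 𝓝ˢ (frontier Ω), ContMDiffAt 𝓘(ℝ, E) 𝓘(ℝ, ℝ) 2 r z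

/-- A defining function is normalized if `|r| / δ → 1` at the boundary. -/
def IsNormalizedDefiningFunction (Ω : Set M) (r : M → ℝ) : Prop :=
  IsDefiningFunction E Ω r ∧
    Tendsto (fun z => |r z| / bdryDist Ω z) (𝓝ˢ (frontier Ω) ⊓ 𝓟 (frontier Ω)ᶜ) (𝓝 1)

/-- The Diederich-Fornæss index `I(Ω)`: the supremum of `I(r)` over all defining functions. -/
def dfIndex (Ω : Set M) : ℝ := sSup {t | ∃ r : M → ℝ, IsDefiningFunction E Ω r ∧ t = dfIndexOf E Ω r}

variable (M) in
/-- The Riemannian metric of `M` is Hermitian: it is invariant under the complex structure. -/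
def IsHermitianMetric [IsManifold 𝓘(ℂ, E) ω M]
    [RiemannianBundle (fun x : M => TangentSpace 𝓘(ℝ, E) x)] : Prop :=
  ∀ (x : M) (ξ ζ : TanSp (E := E) x), inner ℝ (cplxJ x ξ) (cplxJ x ζ) = inner ℝ ξ ζ

/-- The Oka condition with constant `K`: `∂∂̄(-log(-r)) ≥ K ω` on `U ∩ Ω` for some neighbourhood `U`
of the boundary. -/
def OkaCondition [RiemannianBundle (fun x : M => TangentSpace 𝓘(ℝ, E) x)]
    (Ω : Set M) (r : M → ℝ) (K : ℝ) : Prop :=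
  ∀ᶠ z in 𝓝ˢ (frontier Ω), z ∈ Ω → ∀ ξ : TanSp (E := E) z,
    K * sqLength z ξ ≤ cplxHessian (fun w => -Real.log (-r w)) z ξ

end Metric

end

/-!
The given defining function `r` already has every `η < 1 / K₁` as a Diederich-Fornæss exponent, and
`1 / K₁` is at least each of the two terms of the maximum.

Put `t = -r`, `Q = ∂∂̄r`, `L = ∂r`. Multiplied by `t²`, the Oka condition reads
`t Q + |L|² ≥ K t² ω`, and `η` is an exponent iff `t Q + (1 - η) |L|² ≥ 0` near the boundary
(`cplxHessian_neg_log_neg`, `cplxHessian_neg_rpow_neg`). The latter is a local statement at each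
boundary point `p`, and two cases are distinguished.

* At a weakly pseudoconvex point, split `ξ = τ + ν` with `L τ = 0` and `ν ⊥ ker L`. The Oka condition
  for `s τ + ν` with `s = K₁ / (K₁ - 1)`, divided by `s`, bounds the mixed term of `Q` from below.
  With the upper pinching bound for `Q(τ, τ)`, this leaves
  `t Q(ξ) + (1 - η) |L ξ|² ≥ (1 / K₁ - η) |L ν|² - O(t) |ν|²`, and `|ν| = O(|L ν|)` because `dr ≠ 0` on the
  boundary (`nonneg_of_oka_of_pinching`).
* At any other point the Oka condition makes the Levi form nonnegative in the limit
  (`OkaCondition.hessianForm_nonneg`), so it is positive definite. By compactness of the unit sphere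
  `Q + C |L|² ≥ 0` near `p` for some constant `C` (`exists_eventually_add_mul_norm_sq_nonneg`), and it
  suffices that `t C ≤ 1 - η`.

All vectors and forms are treated as real ones. To compare different points, forms are transported
to the chart at `p`; the second derivative of the transition map drops out because it is complex
bilinear. That `dr ≠ 0` on the boundary (`IsDefiningFunction.fderiv_chartRep_ne_zero`) follows from
`|r| ≥ C₁ δ` and the fact that a chart is locally Lipschitz for the Riemannian distance
(`exists_enorm_chartAt_sub_le`).
-/

/-! ### Second derivatives of compositions -/

section SecondDerivatives

variable {E F G : Type*} [NormedAddCommGroup E] [NormedSpace ℝ E] [NormedAddCommGroup F]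
  [NormedSpace ℝ F] [NormedAddCommGroup G] [NormedSpace ℝ G]

lemma fderiv_fderiv_comp {g : F → G} {f : E → F} {x : E} (hg : ContDiffAt ℝ 2 g (f x))
    (hf : ContDiffAt ℝ 2 f x) (v w : E) :
    fderiv ℝ (fderiv ℝ (g ∘ f)) x v w =
      fderiv ℝ (fderiv ℝ g) (f x) (fderiv ℝ f x v) (fderiv ℝ f x w) +
        fderiv ℝ g (f x) (fderiv ℝ (fderiv ℝ f) x v w) := by
  have hf' : ∀ᶠ y in 𝓝 x, ContDiffAt ℝ 2 f y := hf.eventually (by simp)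
  have hg' : ∀ᶠ y in 𝓝 x, ContDiffAt ℝ 2 g (f y) :=
    hf.continuousAt.eventually (hg.eventually (by simp))
  have heq : fderiv ℝ (g ∘ f) =ᶠ[𝓝 x] fun y => (fderiv ℝ g (f y)).comp (fderiv ℝ f y) := by
    filter_upwards [hf', hg'] with y h1 h2
    exact fderiv_comp y (h2.differentiableAt (by simp)) (h1.differentiableAt (by simp))
  have hDg : DifferentiableAt ℝ (fderiv ℝ g) (f x) :=
    (hg.fderiv_right (m := 1) (by norm_num)).differentiableAt (by simp)
  have hDf : DifferentiableAt ℝ (fderiv ℝ f) x :=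
    (hf.fderiv_right (m := 1) (by norm_num)).differentiableAt (by simp)
  have hfx : DifferentiableAt ℝ f x := hf.differentiableAt (by simp)
  have h := (hDg.hasFDerivAt.comp x hfx.hasFDerivAt).clm_comp hDf.hasFDerivAt
  rw [heq.fderiv_eq]
  have h' := h.fderiv
  simp only [Function.comp_def] at h'
  rw [h']
  simp [add_comm]

lemma fderiv_fderiv_real_comp {h h₁ : ℝ → ℝ} {h₂ : ℝ} {u : E → ℝ} {x : E}
    (hu : ContDiffAt ℝ 2 u x) (hh : ∀ᶠ t in 𝓝 (u x), HasDerivAt h (h₁ t) t)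
    (hh₁ : HasDerivAt h₁ h₂ (u x)) (v w : E) :
    fderiv ℝ (fderiv ℝ (h ∘ u)) x v w =
      h₁ (u x) * fderiv ℝ (fderiv ℝ u) x v w + h₂ * (fderiv ℝ u x v * fderiv ℝ u x w) := by
  have heq : fderiv ℝ (h ∘ u) =ᶠ[𝓝 x] fun y => h₁ (u y) • fderiv ℝ u y := by
    filter_upwards [hu.eventually (by simp), hu.continuousAt.eventually hh] with y h1 h2
    exact (h2.comp_hasFDerivAt y (h1.differentiableAt (by simp)).hasFDerivAt).fderiv
  have hDu : DifferentiableAt ℝ (fderiv ℝ u) x :=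
    (hu.fderiv_right (m := 1) (by norm_num)).differentiableAt (by simp)
  have hux : DifferentiableAt ℝ u x := hu.differentiableAt (by simp)
  have h' := ((hh₁.comp_hasFDerivAt x hux.hasFDerivAt).smul hDu.hasFDerivAt).fderiv
  simp only [Function.comp_def, Pi.smul_def'] at h'
  rw [heq.fderiv_eq, h']
  simp
  ring

end SecondDerivatives

/-! ### Complex Hessians on a complex vector space -/

section ComplexSpace

variable {E F : Type*} [NormedAddCommGroup E] [NormedSpace ℂ E] [NormedAddCommGroup F]
  [NormedSpace ℂ F]

lemma fderiv_real_I_smul {f : E → F} {x : E} (hf : DifferentiableAt ℂ f x) (v : E) :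
    fderiv ℝ f x (Complex.I • v) = Complex.I • fderiv ℝ f x v := by
  rw [hf.fderiv_restrictScalars ℝ]
  simp

/-- The second derivative of a holomorphic map is complex bilinear, so that it contributes nothing
to a complex Hessian. -/
lemma fderiv_fderiv_real_I_smul_I_smul {f : E → F} {x : E} (hf : ContDiffAt ℂ 2 f x) (v w : E) :
    fderiv ℝ (fderiv ℝ f) x (Complex.I • v) (Complex.I • w) =
      - fderiv ℝ (fderiv ℝ f) x v w := by
  have heq : fderiv ℝ f =ᶠ[𝓝 x]
      (ContinuousLinearMap.restrictScalarsL ℂ E F ℝ ℝ) ∘ (fderiv ℂ f) := by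
    filter_upwards [hf.eventually (by simp)] with y hy
    exact (hy.differentiableAt (by simp)).fderiv_restrictScalars ℝ
  have hD : DifferentiableAt ℂ (fderiv ℂ f) x :=
    (hf.fderiv_right (m := 1) (by norm_num)).differentiableAt (by simp)
  have hD' := hD.hasFDerivAt.restrictScalars ℝ
  have h := ((ContinuousLinearMap.restrictScalarsL ℂ E F ℝ ℝ).hasFDerivAt.comp x hD').fderiv
  rw [heq.fderiv_eq, h]
  simp [smul_smul]

noncomputable section

/-- The complex Hessian of `u : E → ℝ` at `x` as a real bilinear form; `E` is its own coordinate
space, and `(1,0)`-vectors are represented by real vectors as in `cplxHessian`. -/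
def hessianForm (u : E → ℝ) (x : E) : E →L[ℝ] E →L[ℝ] ℝ :=
  (1 / 2 : ℝ) • (fderiv ℝ (fderiv ℝ u) x +
    (((ContinuousLinearMap.compL ℝ E E ℝ).flip (ContinuousLinearMap.lsmul ℝ ℂ Complex.I)).comp
      (fderiv ℝ (fderiv ℝ u) x)).comp (ContinuousLinearMap.lsmul ℝ ℂ Complex.I))

/-- The form `∂u` at `x` as a real linear map, with the normalization of `delForm`. -/
def delMap (u : E → ℝ) (x : E) : E →L[ℝ] ℂ :=
  (1 / √2 : ℝ) • (Complex.ofRealCLM.comp (fderiv ℝ u x) -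
    (ContinuousLinearMap.lsmul ℝ ℂ Complex.I).comp (Complex.ofRealCLM.comp
      ((fderiv ℝ u x).comp (ContinuousLinearMap.lsmul ℝ ℂ Complex.I))))

lemma hessianForm_apply_self (u : E → ℝ) (x v : E) : hessianForm u x v v =
    (fderiv ℝ (fderiv ℝ u) x v v +
      fderiv ℝ (fderiv ℝ u) x (Complex.I • v) (Complex.I • v)) / 2 := by
  simp [hessianForm]
  ring

lemma delMap_apply (u : E → ℝ) (x v : E) : delMap u x v =
    ((fderiv ℝ u x v : ℝ) - Complex.I * (fderiv ℝ u x (Complex.I • v) : ℝ)) / (√2 : ℝ) := by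
  simp [delMap, div_eq_inv_mul]

lemma norm_sq_delMap (u : E → ℝ) (x v : E) : ‖delMap u x v‖ ^ 2 =
    (fderiv ℝ u x v ^ 2 + fderiv ℝ u x (Complex.I • v) ^ 2) / 2 := by
  rw [delMap_apply, norm_div, div_pow, ← Complex.normSq_eq_norm_sq, Complex.normSq_apply]
  simp
  ring

lemma delMap_complex_smul (u : E → ℝ) (x v : E) (c : ℂ) :
    delMap u x (c • v) = c * delMap u x v := by
  have h1 : c • v = c.re • v + c.im • (Complex.I • v) := by
    conv_lhs => rw [← Complex.re_add_im c]
    rw [add_smul, mul_smul]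
    rfl
  have h2 : delMap u x (Complex.I • v) = Complex.I * delMap u x v := by
    rw [delMap_apply, delMap_apply, smul_smul, Complex.I_mul_I]
    simp only [neg_one_smul, map_neg, Complex.ofReal_neg]
    linear_combination ((fderiv ℝ u x (Complex.I • v) : ℂ) / (√2 : ℝ)) * Complex.I_sq
  rw [h1, map_add, map_smul, map_smul, h2]
  conv_rhs => rw [← Complex.re_add_im c]
  simp only [Complex.real_smul]
  ring

lemma exists_delMap_ne_zero {u : E → ℝ} {x : E} (h : fderiv ℝ u x ≠ 0) :
    ∃ n, delMap u x n ≠ 0 := by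
  obtain ⟨n, hn⟩ : ∃ n, fderiv ℝ u x n ≠ 0 := by
    by_contra! hc
    exact h (by ext v; simpa using hc v)
  refine ⟨n, fun h0 => ?_⟩
  have := norm_sq_delMap u x n
  rw [h0] at this
  have : 0 < fderiv ℝ u x n ^ 2 := by positivity
  nlinarith [sq_nonneg (fderiv ℝ u x (Complex.I • n)), norm_zero (E := ℂ)]

lemma continuousAt_hessianForm {u : E → ℝ} {x : E} (hu : ContDiffAt ℝ 2 u x) :
    ContinuousAt (hessianForm u) x := by
  have h2 : ContinuousAt (fderiv ℝ (fderiv ℝ u)) x :=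
    ((hu.fderiv_right (m := 1) (by norm_num)).fderiv_right (m := 0) (by norm_num)).continuousAt
  exact ContinuousAt.const_smul
    (h2.add ((continuousAt_const.clm_comp h2).clm_comp continuousAt_const)) (1 / 2 : ℝ)

lemma continuousAt_norm_hessianForm {u : E → ℝ} {x : E} (hu : ContDiffAt ℝ 2 u x) :
    ContinuousAt (fun y => ‖hessianForm u y‖) x :=
  (continuous_norm (E := E →L[ℝ] E →L[ℝ] ℝ)).continuousAt.comp (continuousAt_hessianForm hu)

lemma continuousAt_delMap {u : E → ℝ} {x : E} (hu : ContDiffAt ℝ 2 u x) :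
    ContinuousAt (delMap u) x := by
  have h1 : ContinuousAt (fderiv ℝ u) x :=
    (hu.fderiv_right (m := 1) (by norm_num)).continuousAt
  unfold delMap
  fun_prop

lemma hessianForm_comp {f : E → F} {u : F → ℝ} {x : E} (hu : ContDiffAt ℝ 2 u (f x))
    (hf : ContDiffAt ℂ 2 f x) (v : E) : hessianForm (u ∘ f) x v v =
      hessianForm u (f x) (fderiv ℝ f x v) (fderiv ℝ f x v) := by
  have hf' : ContDiffAt ℝ 2 f x := hf.restrict_scalars ℝ
  rw [hessianForm_apply_self, hessianForm_apply_self, fderiv_fderiv_comp hu hf',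
    fderiv_fderiv_comp hu hf', fderiv_fderiv_real_I_smul_I_smul hf,
    fderiv_real_I_smul (hf.differentiableAt (by simp))]
  simp only [map_neg]
  ring

lemma delMap_comp {f : E → F} {u : F → ℝ} {x : E} (hu : DifferentiableAt ℝ u (f x))
    (hf : DifferentiableAt ℂ f x) (v : E) :
    delMap (u ∘ f) x v = delMap u (f x) (fderiv ℝ f x v) := by
  have hf' : DifferentiableAt ℝ f x := hf.restrictScalars ℝ
  rw [delMap_apply, delMap_apply, fderiv_comp x hu hf', ← fderiv_real_I_smul hf]
  simp

/-- `∂∂̄(h ∘ u) = h'(u) ∂∂̄u + h''(u) ∂u ∧ ∂̄u`, with `h₁ = h'` and `h₂ = h''(u x)`. -/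
lemma hessianForm_real_comp {h h₁ : ℝ → ℝ} {h₂ : ℝ} {u : E → ℝ} {x : E}
    (hu : ContDiffAt ℝ 2 u x) (hh : ∀ᶠ t in 𝓝 (u x), HasDerivAt h (h₁ t) t)
    (hh₁ : HasDerivAt h₁ h₂ (u x)) (v : E) : hessianForm (h ∘ u) x v v =
      h₁ (u x) * hessianForm u x v v + h₂ * ‖delMap u x v‖ ^ 2 := by
  rw [hessianForm_apply_self, hessianForm_apply_self, norm_sq_delMap,
    fderiv_fderiv_real_comp hu hh hh₁, fderiv_fderiv_real_comp hu hh hh₁]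
  ring

end

end ComplexSpace

/-! ### Complex Hessians in the preferred chart -/

section Manifold

variable {E : Type*} [NormedAddCommGroup E] [NormedSpace ℂ E]
  {M : Type*} [TopologicalSpace M] [ChartedSpace E M]

lemma cplxHessian_eq_hessianForm (u : M → ℝ) (x : M) (ξ : TanSp (E := E) x) :
    cplxHessian u x ξ = hessianForm (chartRep u x) (chartAt E x x) ξ ξ := by
  have key : ∀ v : E, (iteratedFDeriv ℝ 2 (chartRep u x) (chartAt E x x) (fun _ => v) +
      iteratedFDeriv ℝ 2 (chartRep u x) (chartAt E x x) (fun _ => Complex.I • v)) / 2 =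
      hessianForm (chartRep u x) (chartAt E x x) v v := fun v => by
    rw [hessianForm_apply_self, iteratedFDeriv_two_apply, iteratedFDeriv_two_apply]
  exact key ξ

lemma delForm_eq_delMap (u : M → ℝ) (x : M) (ξ : TanSp (E := E) x) :
    delForm u x ξ = delMap (chartRep u x) (chartAt E x x) ξ := by
  exact (delMap_apply (chartRep u x) (chartAt E x x) ξ).symm

end Manifold

/-! ### Estimates for pairs of forms -/

section Forms

/-- The estimate at the weakly pseudoconvex points. Split `ξ = τ + ν` with `τ ∈ ker L` and
`ν ⊥ ker L`. The Oka inequality at `s τ + ν` with `s = K₁ / (K₁ - 1)` controls the mixed term, and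
this is the value of `s` for which the remaining multiple of `q(τ, τ)` is compensated by the upper
pinching bound. -/
theorem nonneg_of_oka_of_pinching {V : Type*} [NormedAddCommGroup V] [InnerProductSpace ℝ V]
    [FiniteDimensional ℝ V] {q : V →ₗ[ℝ] V →ₗ[ℝ] ℝ} {L : V →ₗ[ℝ] ℂ} {K K₁ t η C D : ℝ}
    (hK₁ : 1 < K₁) (ht : 0 < t)
    (oka : ∀ ξ, K * t ^ 2 * ‖ξ‖ ^ 2 ≤ t * q ξ ξ + ‖L ξ‖ ^ 2)
    (pinch : ∀ ξ, L ξ = 0 → q ξ ξ ≤ K * K₁ * t * ‖ξ‖ ^ 2)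
    (normal : ∀ ξ, ∃ ζ, L ζ = L ξ ∧ ‖ζ‖ ≤ C * ‖L ξ‖)
    (bound : ∀ ξ, |q ξ ξ| ≤ D * ‖ξ‖ ^ 2) (hD : 0 ≤ D)
    (small : (t * D + t ^ 2 * |K|) * C ^ 2 ≤ 1 / K₁ - η) (ξ : V) :
    0 ≤ t * q ξ ξ + (1 - η) * ‖L ξ‖ ^ 2 := by
  obtain ⟨τ, hτ, ν, hν, rfl⟩ := (LinearMap.ker L).exists_add_mem_mem_orthogonal ξ
  rw [LinearMap.mem_ker] at hτ
  have hν_le : ‖ν‖ ≤ C * ‖L ν‖ := by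
    -- `ν` is the shortest vector of its class modulo `ker L`
    obtain ⟨ζ, hζ, hle⟩ := normal ν
    refine le_trans ?_ hle
    have hker : ζ - ν ∈ LinearMap.ker L := by simp [hζ]
    have h0 : inner ℝ (ζ - ν) ν = 0 := (Submodule.mem_orthogonal _ _).1 hν _ hker
    have h1 := norm_add_sq_real (ζ - ν) ν
    rw [h0, sub_add_cancel] at h1
    nlinarith [norm_nonneg ζ, norm_nonneg ν, sq_nonneg ‖ζ - ν‖]
  have hν_sq : ‖ν‖ ^ 2 ≤ C ^ 2 * ‖L ν‖ ^ 2 := by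
    rw [← mul_pow]
    exact pow_le_pow_left₀ (norm_nonneg ν) hν_le 2
  obtain ⟨κ, hκ⟩ : ∃ κ, κ = 1 / K₁ := ⟨_, rfl⟩
  have hκ0 : 0 < κ := by rw [hκ]; positivity
  have hκ1 : κ < 1 := by rw [hκ, div_lt_one (by linarith)]; exact hK₁
  have hκK : κ * K₁ = 1 := by rw [hκ]; field_simp
  have horth : inner ℝ τ ν = 0 := (Submodule.mem_orthogonal _ _).1 hν _ (by simpa using hτ)
  -- rescaled: the Oka inequality at `τ + (1 - κ) ν`, where `1 - κ = 1 / s`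
  have h1 := oka (τ + (1 - κ) • ν)
  have h2 : ‖τ + (1 - κ) • ν‖ ^ 2 = ‖τ‖ ^ 2 + (1 - κ) ^ 2 * ‖ν‖ ^ 2 := by
    rw [norm_add_sq_real, inner_smul_right, horth, norm_smul, mul_pow, Real.norm_eq_abs, sq_abs]
    ring
  have h3 : ‖L (τ + (1 - κ) • ν)‖ ^ 2 = (1 - κ) ^ 2 * ‖L ν‖ ^ 2 := by
    rw [map_add, hτ, zero_add, map_smul, norm_smul, mul_pow, Real.norm_eq_abs, sq_abs]
  rw [h2, h3] at h1
  have h4 := pinch τ hτ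
  have h5 := bound ν
  rw [map_add L, hτ, zero_add]
  simp only [map_add, map_smul, LinearMap.add_apply, LinearMap.smul_apply, smul_eq_mul] at h1 ⊢
  have hl : 0 ≤ ‖L ν‖ ^ 2 := by positivity
  generalize q τ τ = a at *
  generalize q ν ν = b at *
  generalize q τ ν = c at *
  generalize q ν τ = d at *
  generalize ‖L ν‖ ^ 2 = l at *
  generalize ‖τ‖ ^ 2 = x at *
  generalize hy : ‖ν‖ ^ 2 = y at *
  have hy0 : 0 ≤ y := by rw [← hy]; positivity
  have hb : -(D * y) ≤ b := (abs_le.1 h5).1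
  have hK : -(|K| * y) ≤ K * y := by nlinarith [neg_abs_le K]
  have h6 : (t * D + t ^ 2 * |K|) * y ≤ (κ - η) * l := by
    have h60 : 0 ≤ t * D + t ^ 2 * |K| := by positivity
    calc (t * D + t ^ 2 * |K|) * y ≤ (t * D + t ^ 2 * |K|) * (C ^ 2 * l) := by gcongr
      _ = ((t * D + t ^ 2 * |K|) * C ^ 2) * l := by ring
      _ ≤ (κ - η) * l := by rw [hκ]; gcongr
  have h7 : κ * a ≤ K * t * x := by
    calc κ * a ≤ κ * (K * K₁ * t * x) := by gcongr
      _ = (κ * K₁) * (K * t * x) := by ring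
      _ = K * t * x := by rw [hκK, one_mul]
  have hσ : 0 < 1 - κ := by linarith
  have e1 : 0 ≤ t * (K * t * x - κ * a) := mul_nonneg ht.le (by linarith)
  have e2 : 0 ≤ t ^ 2 * (K * y + |K| * y) := mul_nonneg (by positivity) (by linarith)
  have e3 : 0 ≤ t * (b + D * y) := mul_nonneg ht.le (by linarith)
  refine nonneg_of_mul_nonneg_right (a := 1 - κ) ?_ hσ
  have e4 : 0 ≤ t ^ 2 * |K| * y * ((1 - κ) * κ) := by positivity
  have e5 : 0 ≤ t * D * y * ((1 - κ) * (1 - κ)) := by positivity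
  have e6 := mul_nonneg (sq_nonneg (1 - κ)) e2
  have e7 := mul_nonneg (mul_nonneg hσ.le hκ0.le) e3
  have e8 := mul_le_mul_of_nonneg_left h6 hσ.le
  linear_combination h1 + e1 + e4 + e5 + e6 + e7 + e8

/-- If `Q₀` is positive definite on `ker L₀`, then `Q + C |L|²` is positive semidefinite for one
constant `C` and all `(Q, L)` near `(Q₀, L₀)`. -/
theorem exists_eventually_add_mul_norm_sq_nonneg {X E : Type*} [TopologicalSpace X]
    [NormedAddCommGroup E] [NormedSpace ℝ E] [FiniteDimensional ℝ E]
    {Q : X → E →L[ℝ] E →L[ℝ] ℝ} {L : X → E →L[ℝ] ℂ} {x₀ : X} (hQ : ContinuousAt Q x₀)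
    (hL : ContinuousAt L x₀) (hpos : ∀ w, w ≠ 0 → L x₀ w = 0 → 0 < Q x₀ w w) :
    ∃ C : ℝ, 0 < C ∧ ∀ᶠ x in 𝓝 x₀, ∀ w, 0 ≤ Q x w w + C * ‖L x w‖ ^ 2 := by
  have hS : IsCompact (Metric.sphere (0 : E) 1) := isCompact_sphere 0 1
  obtain ⟨N, hN⟩ : ∃ N : ℕ, Metric.sphere (0 : E) 1 ⊆
      {w | 0 < Q x₀ w w + (N + 1 : ℝ) * ‖L x₀ w‖ ^ 2} := by
    refine hS.elim_directed_cover _ (fun N => ?_) (fun w hw => ?_) ?_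
    · exact isOpen_lt continuous_const (by fun_prop)
    · have hw0 : w ≠ 0 := by rintro rfl; simp at hw
      rw [mem_iUnion]
      by_cases h : L x₀ w = 0
      · exact ⟨0, by simpa [h] using hpos w hw0 h⟩
      · have hl : 0 < ‖L x₀ w‖ ^ 2 := by positivity
        obtain ⟨N, hN⟩ := exists_nat_gt (-Q x₀ w w / ‖L x₀ w‖ ^ 2)
        rw [div_lt_iff₀ hl] at hN
        exact ⟨N, by simp only [mem_ofPred_eq]; nlinarith⟩
    · refine directed_of_isDirected_le fun m n hmn w hw => ?_
      have hmn' : (m : ℝ) ≤ n := by exact_mod_cast hmn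
      simp only [mem_ofPred_eq] at hw ⊢
      nlinarith [sq_nonneg ‖L x₀ w‖]
  refine ⟨N + 1, by positivity, ?_⟩
  have hev : ∀ᶠ x in 𝓝 x₀, ∀ w ∈ Metric.sphere (0 : E) 1,
      0 < Q x w w + (N + 1 : ℝ) * ‖L x w‖ ^ 2 := by
    refine hS.eventually_forall_of_forall_eventually fun w hw => ?_
    have hQ' : ContinuousAt (fun y : X × E => Q y.1) (x₀, w) :=
      ContinuousAt.comp (f := Prod.fst) hQ continuousAt_fst
    have hL' : ContinuousAt (fun y : X × E => L y.1) (x₀, w) :=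
      ContinuousAt.comp (f := Prod.fst) hL continuousAt_fst
    have hc : ContinuousAt (fun y : X × E => Q y.1 y.2 y.2 + (N + 1 : ℝ) * ‖L y.1 y.2‖ ^ 2)
        (x₀, w) := ((hQ'.clm_apply continuousAt_snd).clm_apply continuousAt_snd).add
      (continuousAt_const.mul ((hL'.clm_apply continuousAt_snd).norm.pow 2))
    exact hc.eventually (lt_mem_nhds (hN hw))
  filter_upwards [hev] with x hx w
  rcases eq_or_ne w 0 with rfl | hw
  · simp
  have hw' : 0 < ‖w‖ := norm_pos_iff.2 hw
  have h := hx (‖w‖⁻¹ • w) (by simp [norm_smul, hw'.ne'])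
  simp only [map_smul, _root_.smul_apply, smul_eq_mul, norm_smul, norm_inv,
    norm_norm, mul_pow] at h
  have h' : ‖w‖⁻¹ * (‖w‖⁻¹ * Q x w w) + (N + 1 : ℝ) * (‖w‖⁻¹ ^ 2 * ‖L x w‖ ^ 2) =
      ‖w‖⁻¹ ^ 2 * (Q x w w + (N + 1 : ℝ) * ‖L x w‖ ^ 2) := by ring
  rw [h'] at h
  exact (pos_of_mul_pos_right h (by positivity)).le

end Forms

/-! ### Changes of chart and the metric in a chart -/

lemma chartRep_eventuallyEq {E M : Type*} [NormedAddCommGroup E] [TopologicalSpace M]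
    [ChartedSpace E M] (r : M → ℝ) {p z : M} (hz : z ∈ (chartAt E p).source) :
    chartRep r z =ᶠ[𝓝 (chartAt E z z)]
      chartRep r p ∘ (chartAt E p ∘ (chartAt E z).symm) := by
  have h1 : ContinuousAt (chartAt E z).symm (chartAt E z z) :=
    (chartAt E z).continuousAt_symm (mem_chart_target E z)
  have h2 : (chartAt E p).source ∈ 𝓝 ((chartAt E z).symm (chartAt E z z)) := by
    rw [(chartAt E z).left_inv (mem_chart_source E z)]
    exact (chartAt E p).open_source.mem_nhds hz
  filter_upwards [h1 h2] with y hy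
  have hy' : (chartAt E z).symm y ∈ (chartAt E p).source := hy
  simp [chartRep, (chartAt E p).left_inv hy']

lemma hessianForm_congr {E : Type*} [NormedAddCommGroup E] [NormedSpace ℂ E] {u v : E → ℝ} {x : E}
    (h : u =ᶠ[𝓝 x] v) :
    hessianForm u x = hessianForm v x := by
  rw [hessianForm, hessianForm, h.fderiv.fderiv_eq]

lemma delMap_congr {E : Type*} [NormedAddCommGroup E] [NormedSpace ℂ E] {u v : E → ℝ} {x : E}
    (h : u =ᶠ[𝓝 x] v) : delMap u x = delMap v x := by
  rw [delMap, delMap, h.fderiv_eq]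

section ChartChange

variable {E : Type*} [NormedAddCommGroup E] [NormedSpace ℂ E]
  {M : Type*} [TopologicalSpace M] [ChartedSpace E M] [IsManifold 𝓘(ℂ, E) ω M]

lemma contDiffAt_chartRep {r : M → ℝ} {p z : M} (hz : z ∈ (chartAt E p).source)
    (hr : ContMDiffAt 𝓘(ℝ, E) 𝓘(ℝ, ℝ) 2 r z) :
    ContDiffAt ℝ 2 (chartRep r p) (chartAt E p z) := by
  have h := (contMDiffAt_iff_source_of_mem_source (x := p) hz).1 hr
  rw [contMDiffWithinAt_iff_contDiffWithinAt] at h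
  simpa [chartRep, contDiffWithinAt_univ] using h

lemma contDiffAt_chart_transition {p z : M} (hz : z ∈ (chartAt E p).source) :
    ContDiffAt ℂ 2 (chartAt E p ∘ (chartAt E z).symm) (chartAt E z z) := by
  have h := contDiffWithinAt_ext_coord_change (I := 𝓘(ℂ, E)) (n := ω) p z
    (y := chartAt E z z) (by simp [hz])
  have h' : ContDiffAt ℂ ω (chartAt E p ∘ (chartAt E z).symm) (chartAt E z z) := by
    simpa [contDiffWithinAt_univ] using h
  exact h'.of_le le_top

lemma tangentCoordChange_eq_fderiv (p z : M) :
    tangentCoordChange 𝓘(ℝ, E) z p z =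
      fderiv ℝ (chartAt E p ∘ (chartAt E z).symm) (chartAt E z z) := by
  rw [tangentCoordChange_def]
  simp [fderivWithin_univ]

/-- Invariance of the complex Hessian: at every point near `p` it can be computed in the chart
at `p` instead of the preferred chart. -/
lemma cplxHessian_eq_in_chart {r : M → ℝ} {p z : M} (hz : z ∈ (chartAt E p).source)
    (hr : ContMDiffAt 𝓘(ℝ, E) 𝓘(ℝ, ℝ) 2 r z) (ξ : TanSp (E := E) z) :
    cplxHessian r z ξ = hessianForm (chartRep r p) (chartAt E p z)
      (tangentCoordChange 𝓘(ℝ, E) z p z ξ) (tangentCoordChange 𝓘(ℝ, E) z p z ξ) := by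
  have hx : (chartAt E p ∘ (chartAt E z).symm) (chartAt E z z) = chartAt E p z := by
    simp [(chartAt E z).left_inv (mem_chart_source E z)]
  have key := hessianForm_comp (u := chartRep r p) (x := chartAt E z z)
    (by rw [hx]; exact contDiffAt_chartRep hz hr) (contDiffAt_chart_transition hz) ξ
  rw [cplxHessian_eq_hessianForm, hessianForm_congr (chartRep_eventuallyEq r hz),
    tangentCoordChange_eq_fderiv, ← hx]
  exact key

lemma delForm_eq_in_chart {r : M → ℝ} {p z : M} (hz : z ∈ (chartAt E p).source)
    (hr : ContMDiffAt 𝓘(ℝ, E) 𝓘(ℝ, ℝ) 2 r z) (ξ : TanSp (E := E) z) :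
    delForm r z ξ = delMap (chartRep r p) (chartAt E p z)
      (tangentCoordChange 𝓘(ℝ, E) z p z ξ) := by
  have hx : (chartAt E p ∘ (chartAt E z).symm) (chartAt E z z) = chartAt E p z := by
    simp [(chartAt E z).left_inv (mem_chart_source E z)]
  have key := delMap_comp (u := chartRep r p) (x := chartAt E z z)
    (by rw [hx]; exact (contDiffAt_chartRep hz hr).differentiableAt (by simp))
    ((contDiffAt_chart_transition hz).differentiableAt (by simp)) ξ
  rw [delForm_eq_delMap, delMap_congr (chartRep_eventuallyEq r hz),
    tangentCoordChange_eq_fderiv, ← hx]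
  exact key

lemma cplxHessian_real_comp {r : M → ℝ} {z : M} (hr : ContMDiffAt 𝓘(ℝ, E) 𝓘(ℝ, ℝ) 2 r z)
    {h h₁ : ℝ → ℝ} {h₂ : ℝ} (hh : ∀ᶠ t in 𝓝 (r z), HasDerivAt h (h₁ t) t)
    (hh₁ : HasDerivAt h₁ h₂ (r z)) (ξ : TanSp (E := E) z) :
    cplxHessian (fun w => h (r w)) z ξ =
      h₁ (r z) * cplxHessian r z ξ + h₂ * ‖delForm r z ξ‖ ^ 2 := by
  have hx : chartRep r z (chartAt E z z) = r z := by
    simp [chartRep, (chartAt E z).left_inv (mem_chart_source E z)]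
  rw [cplxHessian_eq_hessianForm, cplxHessian_eq_hessianForm, delForm_eq_delMap, ← hx]
  exact hessianForm_real_comp (contDiffAt_chartRep (mem_chart_source E z) hr)
    (by rwa [hx]) (by rwa [hx]) ξ

lemma cplxHessian_neg_log_neg {r : M → ℝ} {z : M} (hr : ContMDiffAt 𝓘(ℝ, E) 𝓘(ℝ, ℝ) 2 r z)
    (hneg : r z < 0) (ξ : TanSp (E := E) z) :
    (-r z) ^ 2 * cplxHessian (fun w => -Real.log (-r w)) z ξ =
      -r z * cplxHessian r z ξ + ‖delForm r z ξ‖ ^ 2 := by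
  have hd : ∀ t : ℝ, t < 0 → HasDerivAt (fun t => -Real.log (-t)) (-t⁻¹) t := fun t ht => by
    have := ((hasDerivAt_neg t).log (neg_pos.2 ht).ne').neg
    convert! this using 1
    field_simp
  have h := cplxHessian_real_comp (E := E) hr (h₁ := fun t => -t⁻¹)
    ((eventually_lt_nhds hneg).mono fun t ht => hd t ht)
    ((hasDerivAt_inv hneg.ne).neg) ξ
  rw [h]
  field_simp [hneg.ne]

lemma cplxHessian_neg_rpow_neg {r : M → ℝ} {z : M} (hr : ContMDiffAt 𝓘(ℝ, E) 𝓘(ℝ, ℝ) 2 r z)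
    (hneg : r z < 0) (η : ℝ) (ξ : TanSp (E := E) z) :
    cplxHessian (fun w => -(-r w) ^ η) z ξ = η * (-r z) ^ (η - 2) *
      (-r z * cplxHessian r z ξ + (1 - η) * ‖delForm r z ξ‖ ^ 2) := by
  have hd : ∀ a t : ℝ, t < 0 → HasDerivAt (fun t : ℝ => (-t) ^ a) (-(a * (-t) ^ (a - 1))) t :=
    fun a t ht => by
      have := (hasDerivAt_neg t).rpow_const (p := a) (Or.inl (neg_pos.2 ht).ne')
      convert! this using 1
      ring
  have h := cplxHessian_real_comp (E := E) hr (h := fun t => -(-t) ^ η)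
    (h₁ := fun t => η * (-t) ^ (η - 1))
    ((eventually_lt_nhds hneg).mono fun t ht => by
      convert! (hd η t ht).neg using 1
      ring)
    ((hd (η - 1) _ hneg).const_mul η) ξ
  have hp : 0 < -r z := neg_pos.2 hneg
  have e1 : (-r z) ^ (η - 1) = (-r z) ^ (η - 2) * (-r z) := by
    rw [← Real.rpow_add_one hp.ne']
    ring_nf
  have e2 : (-r z) ^ (η - 1 - 1) = (-r z) ^ (η - 2) := by ring_nf
  rw [h]
  simp only [e1, e2]
  ring

end ChartChange

section Metric

variable {E : Type*} [NormedAddCommGroup E] [NormedSpace ℂ E]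
  {M : Type*} [EMetricSpace M] [ChartedSpace E M] [IsManifold 𝓘(ℂ, E) ω M]
  [RiemannianBundle (fun x : M => TangentSpace 𝓘(ℝ, E) x)]
  [IsContMDiffRiemannianBundle 𝓘(ℝ, E) ∞ E (fun x : M => TangentSpace 𝓘(ℝ, E) x)]

lemma isContinuousRiemannianBundle_of_contMDiff :
    IsContinuousRiemannianBundle E (fun x : M => TangentSpace 𝓘(ℝ, E) x) := by
  obtain ⟨g, hg, hg'⟩ := IsContMDiffRiemannianBundle.exists_contMDiff (IB := 𝓘(ℝ, E)) (n := ∞)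
    (F := E) (E := fun x : M => TangentSpace 𝓘(ℝ, E) x)
  exact ⟨g, hg.continuous, hg'⟩

/-- In the chart at `p` the Riemannian norm is comparable to the norm of the model space, uniformly
near `p`; the second part bounds the inverse of the coordinate change. -/
lemma exists_norm_tangentCoordChange_le (p : M) : ∃ C : ℝ, 0 < C ∧ ∀ᶠ z in 𝓝 p,
    (∀ ξ : TangentSpace 𝓘(ℝ, E) z,
      ‖(tangentCoordChange 𝓘(ℝ, E) z p z ξ : E)‖ ≤ C * ‖ξ‖) ∧
    ∀ w : E, ∃ ζ : TangentSpace 𝓘(ℝ, E) z,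
      tangentCoordChange 𝓘(ℝ, E) z p z ζ = w ∧ ‖ζ‖ ≤ C * ‖w‖ := by
  have : IsContinuousRiemannianBundle E (fun x : M => TangentSpace 𝓘(ℝ, E) x) :=
    isContinuousRiemannianBundle_of_contMDiff
  obtain ⟨C₁, hC₁, h₁⟩ :=
    eventually_norm_trivializationAt_lt E (fun x : M => TangentSpace 𝓘(ℝ, E) x) p
  obtain ⟨C₂, hC₂, h₂⟩ :=
    eventually_norm_symmL_trivializationAt_lt E (fun x : M => TangentSpace 𝓘(ℝ, E) x) p
  refine ⟨max C₁ C₂, lt_max_of_lt_left hC₁, ?_⟩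
  filter_upwards [h₁, h₂, chart_source_mem_nhds E p] with z hz₁ hz₂ hz
  have hT := TangentBundle.continuousLinearMapAt_trivializationAt_eq_core (I := 𝓘(ℝ, E)) hz
  have hT' : ∀ ξ : TangentSpace 𝓘(ℝ, E) z, tangentCoordChange 𝓘(ℝ, E) z p z ξ =
    (trivializationAt E (TangentSpace 𝓘(ℝ, E)) p).continuousLinearMapAt ℝ z ξ :=
    fun ξ => (DFunLike.congr_fun hT ξ).symm
  refine ⟨fun ξ => ?_, fun w => ?_⟩
  · rw [hT']
    refine (ContinuousLinearMap.le_opNorm _ _).trans ?_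
    gcongr
    exact hz₁.le.trans (le_max_left _ _)
  · refine ⟨(trivializationAt E (TangentSpace 𝓘(ℝ, E)) p).symmL ℝ z w, ?_, ?_⟩
    · rw [hT']
      exact (trivializationAt E (TangentSpace 𝓘(ℝ, E)) p).continuousLinearMapAt_symmL
        (by simpa using hz) w
    · refine (ContinuousLinearMap.le_opNorm _ _).trans ?_
      gcongr
      exact hz₂.le.trans (le_max_right _ _)

end Metric

/-! ### Nondegeneracy of the defining function -/

lemma IsDefiningFunction.eq_zero_of_mem_frontier {E : Type*} [NormedAddCommGroup E]
    [NormedSpace ℂ E] {M : Type*} [EMetricSpace M] [ChartedSpace E M] {Ω : Set M} {r : M → ℝ}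
    (hr : IsDefiningFunction E Ω r) {p : M} (hp : p ∈ frontier Ω) : r p = 0 := by
  obtain ⟨C₁, C₂, -, -, h⟩ := hr.comparable
  have h' := (h.self_of_nhdsSet p hp).2
  simpa [bdryDist, Metric.infEDist_zero_of_mem hp] using h'

section Distance

open scoped ENNReal NNReal

variable {E : Type*} [NormedAddCommGroup E] [NormedSpace ℂ E]
  {M : Type*} [EMetricSpace M] [ChartedSpace E M] [IsManifold 𝓘(ℂ, E) ω M]
  [RiemannianBundle (fun x : M => TangentSpace 𝓘(ℝ, E) x)]
  [IsContMDiffRiemannianBundle 𝓘(ℝ, E) ∞ E (fun x : M => TangentSpace 𝓘(ℝ, E) x)]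
  [IsRiemannianManifold 𝓘(ℝ, E) M]

/-- A chart is locally Lipschitz for the Riemannian distance: short paths stay where its differential
is bounded. -/
lemma exists_enorm_chartAt_sub_le (p : M) : ∃ C : ℝ≥0, 0 < C ∧ ∃ s ∈ 𝓝 p, ∀ z ∈ s, ∀ q ∈ s,
    ‖chartAt E p z - chartAt E p q‖ₑ ≤ C * edist z q := by
  obtain ⟨C, hC, h⟩ := exists_norm_tangentCoordChange_le (E := E) p
  obtain ⟨ε, hε, hball⟩ := EMetric.mem_nhds_iff.1 (h.and (chart_source_mem_nhds E p))
  have hC' : (0 : ℝ≥0∞) < ENNReal.ofReal C := ENNReal.ofReal_pos.2 hC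
  refine ⟨C.toNNReal, Real.toNNReal_pos.2 hC, Metric.eball p (ε / 2 / 2),
    Metric.eball_mem_nhds p (by simpa using hε.ne'), fun z hz q hq => ?_⟩
  change _ ≤ ENNReal.ofReal C * edist z q
  by_contra! hlt
  set X := ‖chartAt E p z - chartAt E p q‖ₑ with hX
  have hzq : edist z q < ε / 2 := by
    calc edist z q ≤ edist z p + edist q p := edist_triangle_right z q p
      _ < ε / 2 / 2 + ε / 2 / 2 := ENNReal.add_lt_add hz hq
      _ = ε / 2 := ENNReal.add_halves _
  have hlt' : edist z q < min (X / ENNReal.ofReal C) (ε / 2) := by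
    refine lt_min ?_ hzq
    rw [ENNReal.lt_div_iff_mul_lt (Or.inl hC'.ne') (Or.inl ENNReal.ofReal_ne_top), mul_comm]
    exact hlt
  rw [IsRiemannianManifold.out (I := 𝓘(ℝ, E)) z q] at hlt'
  obtain ⟨γ, hγ0, hγ1, hγ, hlen⟩ := exists_lt_of_riemannianEDist_lt hlt'
  -- the path is too short to leave the ball in which the chart is controlled
  have hmem : ∀ t ∈ Icc (0 : ℝ) 1, γ t ∈ Metric.eball p ε := by
    intro t ht
    have h1 : edist z (γ t) < ε / 2 := by
      rw [IsRiemannianManifold.out (I := 𝓘(ℝ, E)) z (γ t)]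
      calc riemannianEDist 𝓘(ℝ, E) z (γ t) ≤ pathELength 𝓘(ℝ, E) γ 0 t :=
            riemannianEDist_le_pathELength (hγ.mono (Icc_subset_Icc_right ht.2)) hγ0 rfl ht.1
        _ ≤ pathELength 𝓘(ℝ, E) γ 0 1 := pathELength_mono le_rfl ht.2
        _ < ε / 2 := hlen.trans_le (min_le_right _ _)
    calc edist (γ t) p ≤ edist z (γ t) + edist z p := edist_triangle_left _ _ _
      _ < ε / 2 + ε / 2 / 2 := ENNReal.add_lt_add h1 hz
      _ ≤ ε / 2 + ε / 2 := by gcongr; exact ENNReal.half_le_self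
      _ = ε := ENNReal.add_halves _
  have hsrc : ∀ t ∈ Icc (0 : ℝ) 1, γ t ∈ (chartAt E p).source := fun t ht =>
    (hball (hmem t ht)).2
  have hγ' : ContMDiffOn 𝓘(ℝ, ℝ) 𝓘(ℝ, E) 1 (chartAt E p ∘ γ) (Icc 0 1) :=
    contMDiffOn_chart.comp (I' := 𝓘(ℝ, E)) (t := (chartAt E p).source) hγ hsrc
  have hder : ∀ t ∈ Icc (0 : ℝ) 1, ‖derivWithin (chartAt E p ∘ γ) (Icc 0 1) t‖ₑ ≤
      ENNReal.ofReal C * ‖mfderivWithin 𝓘(ℝ, ℝ) 𝓘(ℝ, E) γ (Icc 0 1) t 1‖ₑ := by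
    intro t ht
    have h1 : mfderivWithin 𝓘(ℝ, ℝ) 𝓘(ℝ, E) (chartAt E p ∘ γ) (Icc 0 1) t =
        (mfderiv 𝓘(ℝ, E) 𝓘(ℝ, E) (chartAt E p) (γ t)).comp
          (mfderivWithin 𝓘(ℝ, ℝ) 𝓘(ℝ, E) γ (Icc 0 1) t) := by
      apply mfderiv_comp_mfderivWithin
      · exact mdifferentiableAt_atlas (chart_mem_atlas E p) (hsrc t ht)
      · exact hγ.mdifferentiableOn one_ne_zero t ht
      · rw [uniqueMDiffWithinAt_iff_uniqueDiffWithinAt]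
        exact uniqueDiffOn_Icc zero_lt_one t ht
    have h2 := mfderiv_chartAt_eq_tangentCoordChange (I := 𝓘(ℝ, E)) (hsrc t ht)
    have h3 : derivWithin (chartAt E p ∘ γ) (Icc 0 1) t =
        tangentCoordChange 𝓘(ℝ, E) (γ t) p (γ t)
          (mfderivWithin 𝓘(ℝ, ℝ) 𝓘(ℝ, E) γ (Icc 0 1) t 1) := by
      rw [← fderivWithin_derivWithin, ← mfderivWithin_eq_fderivWithin, h1, h2]
      rfl
    rw [h3]
    have h4 := (hball (hmem t ht)).1.1 (mfderivWithin 𝓘(ℝ, ℝ) 𝓘(ℝ, E) γ (Icc 0 1) t 1)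
    rw [← ofReal_norm, ← ofReal_norm, ← ENNReal.ofReal_mul hC.le]
    exact ENNReal.ofReal_le_ofReal h4
  have hcalc : X ≤ ENNReal.ofReal C * pathELength 𝓘(ℝ, E) γ 0 1 := by
    calc X = ‖(chartAt E p ∘ γ) 1 - (chartAt E p ∘ γ) 0‖ₑ := by
          simp only [Function.comp_apply, hγ0, hγ1, hX]
          rw [← enorm_neg, neg_sub]
      _ ≤ ∫⁻ t in Icc 0 1, ‖derivWithin (chartAt E p ∘ γ) (Icc 0 1) t‖ₑ := by
          apply enorm_sub_le_lintegral_derivWithin_Icc_of_contDiffOn_Icc _ zero_le_one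
          rwa [← contMDiffOn_iff_contDiffOn]
      _ ≤ ∫⁻ t in Icc 0 1,
          ENNReal.ofReal C * ‖mfderivWithin 𝓘(ℝ, ℝ) 𝓘(ℝ, E) γ (Icc 0 1) t 1‖ₑ :=
          MeasureTheory.setLIntegral_mono' measurableSet_Icc hder
      _ = ENNReal.ofReal C * pathELength 𝓘(ℝ, E) γ 0 1 := by
          rw [MeasureTheory.lintegral_const_mul' _ _ ENNReal.ofReal_ne_top,
            pathELength_eq_lintegral_mfderivWithin_Icc]
  refine absurd hcalc (not_le.2 ?_)
  rw [mul_comm, ← ENNReal.lt_div_iff_mul_lt (Or.inl hC'.ne') (Or.inl ENNReal.ofReal_ne_top)]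
  exact hlen.trans_le (min_le_left _ _)

/-- The function that cuts out `Ω` near a boundary point vanishes on the boundary and is Lipschitz in
a chart, hence it is bounded by the distance to the boundary. -/
lemma exists_abs_le_mul_bdryDist {Ω : Set M} (hopen : IsOpen Ω) {p : M} (hp : p ∈ frontier Ω)
    {ρ : M → ℝ} (hρ : ContMDiffAt 𝓘(ℝ, E) 𝓘(ℝ, ℝ) 2 ρ p)
    (hΩ : ∀ᶠ z in 𝓝 p, (z ∈ Ω ↔ ρ z < 0)) :
    ∃ C : ℝ, 0 < C ∧ ∀ᶠ z in 𝓝 p, |ρ z| ≤ C * bdryDist Ω z := by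
  obtain ⟨C₁, hC₁, s, hs, hlip⟩ := exists_enorm_chartAt_sub_le (E := E) p
  obtain ⟨C₂, u, hu, hlip'⟩ := ((contDiffAt_chartRep (mem_chart_source E p) hρ).of_le
    one_le_two).exists_lipschitzOnWith
  have hφ : ContinuousAt (chartAt E p) p := (chartAt E p).continuousAt (mem_chart_source E p)
  have hcont : ∀ᶠ q in 𝓝 p, ContinuousAt ρ q :=
    ((contMDiffAt_iff_contMDiffAt_nhds (by simp)).1 hρ).mono fun q hq => hq.continuousAt
  have hzero : ∀ᶠ q in 𝓝 p, q ∈ frontier Ω → ρ q = 0 := by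
    filter_upwards [hcont, hΩ.eventually_nhds] with q hq hq' hqf
    refine le_antisymm (not_lt.1 fun hpos => ?_) (not_lt.1 fun hneg => ?_)
    · obtain ⟨w, hw, hw', hw''⟩ := ((mem_closure_iff_frequently.1 hqf.1).and_eventually
        (hq'.and (hq.eventually (lt_mem_nhds hpos)))).exists
      exact lt_asymm hw'' (hw'.1 hw)
    · rw [hopen.frontier_eq] at hqf
      exact hqf.2 (hq'.self_of_nhds.2 hneg)
  obtain ⟨ε, hε, hball⟩ := EMetric.mem_nhds_iff.1
    (inter_mem (inter_mem (inter_mem hs (hφ hu)) (chart_source_mem_nhds E p)) hzero)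
  have hle : ∀ z ∈ Metric.eball p ε, ∀ q ∈ Metric.eball p ε,
      ‖ρ z - ρ q‖ₑ ≤ (C₂ + 1) * C₁ * edist z q := by
    intro z hz q hq
    obtain ⟨⟨⟨hzs, hzu⟩, hzc⟩, -⟩ := hball hz
    obtain ⟨⟨⟨hqs, hqu⟩, hqc⟩, -⟩ := hball hq
    have h1 := hlip' hzu hqu
    simp only [chartRep, Function.comp_apply, (chartAt E p).left_inv hzc,
      (chartAt E p).left_inv hqc] at h1
    rw [edist_eq_enorm_sub, edist_eq_enorm_sub] at h1
    calc ‖ρ z - ρ q‖ₑ ≤ C₂ * ‖chartAt E p z - chartAt E p q‖ₑ := h1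
      _ ≤ (C₂ + 1) * (C₁ * edist z q) := by
        gcongr
        · exact le_self_add
        · exact hlip z hzs q hqs
      _ = _ := by ring
  refine ⟨(C₂ + 1) * C₁, by positivity, ?_⟩
  filter_upwards [Metric.eball_mem_nhds p (ENNReal.half_pos hε.ne'),
    Metric.eball_mem_nhds p one_pos] with z hz hz1
  have hfin : Metric.infEDist z (frontier Ω) ≠ ⊤ :=
    ((Metric.infEDist_le_edist_of_mem hp).trans_lt (hz1.trans ENNReal.one_lt_top)).ne
  have hL0 : ((C₂ + 1) * C₁ : ℝ≥0∞) ≠ 0 := by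
    simp [hC₁.ne']
  have hLtop : ((C₂ + 1) * C₁ : ℝ≥0∞) ≠ ⊤ := by finiteness
  have main : ‖ρ z‖ₑ ≤ (C₂ + 1) * C₁ * Metric.infEDist z (frontier Ω) := by
    by_contra! hlt
    have h1 : Metric.infEDist z (frontier Ω) < min (‖ρ z‖ₑ / ((C₂ + 1) * C₁)) (ε / 2) := by
      refine lt_min ?_ ((Metric.infEDist_le_edist_of_mem hp).trans_lt hz)
      rw [ENNReal.lt_div_iff_mul_lt (Or.inl hL0) (Or.inl hLtop), mul_comm]
      exact hlt
    obtain ⟨q, hq, hzq⟩ := Metric.infEDist_lt_iff.1 h1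
    have hqε : q ∈ Metric.eball p ε := by
      calc edist q p ≤ edist z q + edist z p := edist_triangle_left _ _ _
        _ < ε / 2 + ε / 2 := ENNReal.add_lt_add (hzq.trans_le (min_le_right _ _)) hz
        _ = ε := ENNReal.add_halves _
    have hzε : z ∈ Metric.eball p ε := Metric.eball_subset_eball ENNReal.half_le_self hz
    have h2 := hle z hzε q hqε
    rw [(hball hqε).2 hq, sub_zero] at h2
    refine absurd h2 (not_le.2 ?_)
    rw [mul_comm, ← ENNReal.lt_div_iff_mul_lt (Or.inl hL0) (Or.inl hLtop)]
    exact hzq.trans_le (min_le_left _ _)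
  have h := ENNReal.toReal_mono (ENNReal.mul_ne_top hLtop hfin) main
  rw [ENNReal.toReal_mul] at h
  simpa [bdryDist, ENNReal.toReal_add] using h

/-- The differential of a defining function does not vanish at the boundary: the function that cuts
out `Ω` is bounded by a multiple of the distance to the boundary, hence of `|r|`, so its
differential would vanish, too. -/
theorem IsDefiningFunction.fderiv_chartRep_ne_zero {Ω : Set M} (hopen : IsOpen Ω)
    (hC2 : HasC2Boundary E Ω) {r : M → ℝ} (hr : IsDefiningFunction E Ω r) {p : M}
    (hp : p ∈ frontier Ω) : fderiv ℝ (chartRep r p) (chartAt E p p) ≠ 0 := by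
  intro h0
  obtain ⟨ρ, hρ, hdρ, hΩ⟩ := hC2 p hp
  obtain ⟨C, hC, hle⟩ := exists_abs_le_mul_bdryDist hopen hp hρ hΩ
  obtain ⟨C₁, C₂, hC₁, -, hcomp⟩ := hr.comparable
  have hcomp' := eventually_nhdsSet_iff_forall.1 hcomp p hp
  have hp' := (chartAt E p).left_inv (mem_chart_source E p)
  have hsymm : Tendsto (chartAt E p).symm (𝓝 (chartAt E p p)) (𝓝 p) := by
    have := (chartAt E p).continuousAt_symm (mem_chart_target E p)
    rwa [ContinuousAt, hp'] at this
  have hO : chartRep ρ p =O[𝓝 (chartAt E p p)] chartRep r p := by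
    refine Asymptotics.IsBigO.of_bound (C / C₁) ?_
    filter_upwards [hsymm.eventually hle, hsymm.eventually hcomp'] with x h1 h2
    simp only [chartRep, Function.comp_apply, Real.norm_eq_abs]
    rw [div_mul_eq_mul_div, le_div_iff₀ hC₁]
    nlinarith [h2.1]
  have hr0 : chartRep r p (chartAt E p p) = 0 := by
    simp [chartRep, hp', hr.eq_zero_of_mem_frontier hp]
  have hρ0 : chartRep ρ p (chartAt E p p) = 0 := by
    have h := hle.self_of_nhds
    simpa [chartRep, hp', bdryDist, Metric.infEDist_zero_of_mem hp] using h
  have hrd : HasFDerivAt (chartRep r p) (0 : E →L[ℝ] ℝ) (chartAt E p p) := by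
    rw [← h0]
    exact ((contDiffAt_chartRep (mem_chart_source E p)
      (hr.contMDiffAt.self_of_nhdsSet p hp)).differentiableAt (by simp)).hasFDerivAt
  have hρd : HasFDerivAt (chartRep ρ p) (0 : E →L[ℝ] ℝ) (chartAt E p p) := by
    rw [hasFDerivAt_iff_isLittleO] at hrd ⊢
    simp only [hr0, hρ0, sub_zero, _root_.zero_apply] at hrd ⊢
    exact hO.trans_isLittleO hrd
  apply hdρ
  refine (hρ.mdifferentiableAt (by simp)).mfderiv.trans ?_
  have h1 : writtenInExtChartAt 𝓘(ℝ, E) 𝓘(ℝ, ℝ) p ρ = chartRep ρ p := by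
    simp only [chartRep, writtenInExtChartAt, mfld_simps]
    rfl
  have h2 : fderivWithin ℝ (writtenInExtChartAt 𝓘(ℝ, E) 𝓘(ℝ, ℝ) p ρ) (range 𝓘(ℝ, E))
      (extChartAt 𝓘(ℝ, E) p p) = 0 := by
    rw [h1]
    simpa [fderivWithin_univ] using hρd.fderiv
  exact h2

end Distance

/-! ### The Diederich-Fornæss inequality near a boundary point -/

section StrictlyPseudoconvex

variable {E : Type*} [NormedAddCommGroup E] [NormedSpace ℂ E] [FiniteDimensional ℂ E]
  {M : Type*} [EMetricSpace M] [ChartedSpace E M] [IsManifold 𝓘(ℂ, E) ω M]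

/-- Near a strictly pseudoconvex boundary point, every `η < 1` satisfies the Diederich-Fornæss
inequality. -/
lemma eventually_nonneg_of_pos {Ω : Set M} {r : M → ℝ} (hr : IsDefiningFunction E Ω r) {p : M}
    (hp : p ∈ frontier Ω) {η : ℝ} (hη : η < 1)
    (hpos : ∀ w : E, w ≠ 0 → delMap (chartRep r p) (chartAt E p p) w = 0 →
      0 < hessianForm (chartRep r p) (chartAt E p p) w w) :
    ∀ᶠ z in 𝓝 p, z ∈ Ω → ∀ ξ : TangentSpace 𝓘(ℝ, E) z,
      0 ≤ -r z * cplxHessian r z ξ + (1 - η) * ‖delForm r z ξ‖ ^ 2 := by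
  have hC2r := eventually_nhdsSet_iff_forall.1 hr.contMDiffAt p hp
  have hR := contDiffAt_chartRep (mem_chart_source E p) hC2r.self_of_nhds
  have hφ : ContinuousAt (chartAt E p) p := (chartAt E p).continuousAt (mem_chart_source E p)
  have : FiniteDimensional ℝ E := FiniteDimensional.complexToReal E
  obtain ⟨C, hC, hev⟩ := exists_eventually_add_mul_norm_sq_nonneg (continuousAt_hessianForm hR)
    (continuousAt_delMap hR) hpos
  have hsmall : ∀ᶠ z in 𝓝 p, -r z * C < 1 - η := by
    have hc : ContinuousAt (fun z => -r z * C) p :=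
      hr.continuous.continuousAt.neg.mul continuousAt_const
    exact hc.eventually (gt_mem_nhds (by simp [hr.eq_zero_of_mem_frontier hp, hη]))
  filter_upwards [hφ.eventually hev, hsmall, hC2r, chart_source_mem_nhds E p]
    with z hz hzs hzr hsrc hzΩ ξ
  have ht : 0 < -r z := neg_pos.2 (hr.neg z hzΩ)
  have h := mul_nonneg ht.le (hz (tangentCoordChange 𝓘(ℝ, E) z p z ξ))
  rw [← cplxHessian_eq_in_chart hsrc hzr, ← delForm_eq_in_chart hsrc hzr] at h
  nlinarith [sq_nonneg ‖delForm r z ξ‖]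

end StrictlyPseudoconvex

section BoundaryPoint

variable {E : Type*} [NormedAddCommGroup E] [NormedSpace ℂ E]
  {M : Type*} [EMetricSpace M] [ChartedSpace E M]
  [RiemannianBundle (fun x : M => TangentSpace 𝓘(ℝ, E) x)]

lemma sqLength_eq_norm_sq (z : M) (ξ : TangentSpace 𝓘(ℝ, E) z) : sqLength z ξ = ‖ξ‖ ^ 2 :=
  real_inner_self_eq_norm_sq ξ

variable [IsManifold 𝓘(ℂ, E) ω M]

/-- The Oka condition, multiplied by `r²`. -/
lemma OkaCondition.eventually_le {Ω : Set M} {r : M → ℝ} {K : ℝ} (hOka : OkaCondition E Ω r K)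
    (hr : IsDefiningFunction E Ω r) {p : M} (hp : p ∈ frontier Ω) :
    ∀ᶠ z in 𝓝 p, z ∈ Ω → ∀ ξ : TangentSpace 𝓘(ℝ, E) z,
      K * (-r z) ^ 2 * ‖ξ‖ ^ 2 ≤ -r z * cplxHessian r z ξ + ‖delForm r z ξ‖ ^ 2 := by
  filter_upwards [eventually_nhdsSet_iff_forall.1 hOka p hp,
    eventually_nhdsSet_iff_forall.1 hr.contMDiffAt p hp] with z h hz hzΩ ξ
  rw [← cplxHessian_neg_log_neg hz (hr.neg z hzΩ), ← sqLength_eq_norm_sq]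
  have := mul_le_mul_of_nonneg_left (h hzΩ ξ) (sq_nonneg (-r z))
  linarith

variable [IsContMDiffRiemannianBundle 𝓘(ℝ, E) ∞ E (fun x : M => TangentSpace 𝓘(ℝ, E) x)]
  [IsRiemannianManifold 𝓘(ℝ, E) M]

/-- The Oka condition makes the boundary pseudoconvex: a complex tangential vector `w` at `p` is the
limit of tangential vectors at points of `Ω`, on which `∂∂̄r` is at least `-K r |w|²`. -/
lemma OkaCondition.hessianForm_nonneg {Ω : Set M} (hopen : IsOpen Ω) (hC2 : HasC2Boundary E Ω)
    {r : M → ℝ} {K : ℝ} (hOka : OkaCondition E Ω r K) (hr : IsDefiningFunction E Ω r) {p : M}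
    (hp : p ∈ frontier Ω) {w : E} (hw : delMap (chartRep r p) (chartAt E p p) w = 0) :
    0 ≤ hessianForm (chartRep r p) (chartAt E p p) w w := by
  have hC2r := eventually_nhdsSet_iff_forall.1 hr.contMDiffAt p hp
  have hR := contDiffAt_chartRep (mem_chart_source E p) hC2r.self_of_nhds
  have hφ : ContinuousAt (chartAt E p) p := (chartAt E p).continuousAt (mem_chart_source E p)
  obtain ⟨n, hn⟩ := exists_delMap_ne_zero (hr.fderiv_chartRep_ne_zero hopen hC2 hp)
  obtain ⟨C, hC, hCz⟩ := exists_norm_tangentCoordChange_le (E := E) p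
  set R : E → ℝ := chartRep r p with hRdef
  have hQc : ContinuousAt (fun z => hessianForm R (chartAt E p z)) p :=
    ContinuousAt.comp (g := hessianForm R) (continuousAt_hessianForm hR) hφ
  have hLc : ContinuousAt (fun z => delMap R (chartAt E p z)) p :=
    ContinuousAt.comp (g := delMap R) (continuousAt_delMap hR) hφ
  -- `W z` is `w` corrected to be tangential at `z`
  set W : M → E := fun z =>
    w - (delMap R (chartAt E p z) w / delMap R (chartAt E p z) n) • n with hW
  have hWc : ContinuousAt W p := continuousAt_const.sub
    (((hLc.clm_apply continuousAt_const).div (hLc.clm_apply continuousAt_const) hn).smul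
      continuousAt_const)
  have hWp : W p = w := by simp [hW, hw]
  have hF : ContinuousAt (fun z => hessianForm R (chartAt E p z) (W z) (W z) +
      |K| * (-r z) * (C * ‖W z‖) ^ 2) p :=
    ((hQc.clm_apply hWc).clm_apply hWc).add ((continuousAt_const.mul
      hr.continuous.continuousAt.neg).mul ((continuousAt_const.mul hWc.norm).pow 2))
  have hmem : (𝓝[Ω] p).NeBot := mem_closure_iff_nhdsWithin_neBot.1 hp.1
  have hge : ∀ᶠ z in 𝓝[Ω] p, 0 ≤ hessianForm R (chartAt E p z) (W z) (W z) +
      |K| * (-r z) * (C * ‖W z‖) ^ 2 := by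
    filter_upwards [nhdsWithin_le_nhds (hOka.eventually_le hr hp), nhdsWithin_le_nhds hC2r,
      nhdsWithin_le_nhds hCz, nhdsWithin_le_nhds (chart_source_mem_nhds E p),
      nhdsWithin_le_nhds ((hLc.clm_apply continuousAt_const).eventually_ne hn),
      self_mem_nhdsWithin] with z hoka hz hTz hsrc hnz hzΩ
    have ht : 0 < -r z := neg_pos.2 (hr.neg z hzΩ)
    obtain ⟨ζ, hζ, hζle⟩ := hTz.2 (W z)
    have h1 := hoka hzΩ ζ
    have hLW : delMap R (chartAt E p z) (W z) = 0 := by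
      simp only [hW]
      rw [map_sub, delMap_complex_smul, div_mul_cancel₀ _ hnz, sub_self]
    rw [cplxHessian_eq_in_chart hsrc hz, delForm_eq_in_chart hsrc hz, hζ, ← hRdef, hLW, norm_zero,
      zero_pow two_ne_zero, add_zero] at h1
    have h2 : ‖ζ‖ ^ 2 ≤ (C * ‖W z‖) ^ 2 := pow_le_pow_left₀ (norm_nonneg ζ) hζle 2
    have h3 : -(|K| * (-r z) ^ 2 * (C * ‖W z‖) ^ 2) ≤ K * (-r z) ^ 2 * ‖ζ‖ ^ 2 := by
      calc -(|K| * (-r z) ^ 2 * (C * ‖W z‖) ^ 2) ≤ -(|K| * (-r z) ^ 2 * ‖ζ‖ ^ 2) := by gcongr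
        _ = -|K| * ((-r z) ^ 2 * ‖ζ‖ ^ 2) := by ring
        _ ≤ K * ((-r z) ^ 2 * ‖ζ‖ ^ 2) :=
          mul_le_mul_of_nonneg_right (neg_abs_le K) (by positivity)
        _ = _ := by ring
    refine nonneg_of_mul_nonneg_right (a := -r z) ?_ ht
    linear_combination h1 + h3
  have h := ge_of_tendsto (hF.tendsto.mono_left nhdsWithin_le_nhds) hge
  simpa [hWp, hr.eq_zero_of_mem_frontier hp] using h

variable [FiniteDimensional ℂ E]

/-- Near a boundary point with the upper pinching bound, every `η < 1 / K₁` satisfies the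
Diederich-Fornæss inequality. -/
lemma eventually_nonneg_of_pinching {Ω : Set M} (hopen : IsOpen Ω) (hC2 : HasC2Boundary E Ω)
    {r : M → ℝ} {K : ℝ} (hOka : OkaCondition E Ω r K) (hr : IsDefiningFunction E Ω r) {p : M}
    (hp : p ∈ frontier Ω) {K₁ η : ℝ} (hK₁ : 1 < K₁) (hη : η < 1 / K₁)
    (hpinch : ∀ᶠ z in 𝓝 p, z ∈ Ω → ∀ ξ : TangentSpace 𝓘(ℝ, E) z, delForm r z ξ = 0 →
      cplxHessian r z ξ / (-r z) ≤ K * K₁ * sqLength z ξ) :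
    ∀ᶠ z in 𝓝 p, z ∈ Ω → ∀ ξ : TangentSpace 𝓘(ℝ, E) z,
      0 ≤ -r z * cplxHessian r z ξ + (1 - η) * ‖delForm r z ξ‖ ^ 2 := by
  have hC2r := eventually_nhdsSet_iff_forall.1 hr.contMDiffAt p hp
  have hR := contDiffAt_chartRep (mem_chart_source E p) hC2r.self_of_nhds
  have hφ : ContinuousAt (chartAt E p) p := (chartAt E p).continuousAt (mem_chart_source E p)
  have : FiniteDimensional ℝ E := FiniteDimensional.complexToReal E
  obtain ⟨n, hn⟩ := exists_delMap_ne_zero (hr.fderiv_chartRep_ne_zero hopen hC2 hp)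
  obtain ⟨C, hC, hCz⟩ := exists_norm_tangentCoordChange_le (E := E) p
  set R : E → ℝ := chartRep r p with hRdef
  have hLc : ContinuousAt (fun z => delMap R (chartAt E p z)) p :=
    ContinuousAt.comp (g := delMap R) (continuousAt_delMap hR) hφ
  set D := ‖hessianForm R (chartAt E p p)‖ + 1 with hD
  set m := ‖delMap R (chartAt E p p) n‖ / 2 with hm
  have hm0 : 0 < m := by positivity
  have hD0 : 0 < D := by positivity
  have hQle : ∀ᶠ z in 𝓝 p, ‖hessianForm R (chartAt E p z)‖ < D :=
    (ContinuousAt.comp (g := fun x => ‖hessianForm R x‖) (continuousAt_norm_hessianForm hR)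
      hφ).eventually (gt_mem_nhds (lt_add_one _))
  have hLge : ∀ᶠ z in 𝓝 p, m < ‖delMap R (chartAt E p z) n‖ :=
    (hLc.clm_apply continuousAt_const).norm.eventually (lt_mem_nhds (half_lt_self (by positivity)))
  have hsmall : ∀ᶠ z in 𝓝 p,
      (-r z * (D * C ^ 2) + (-r z) ^ 2 * |K|) * (C * ‖n‖ / m) ^ 2 < 1 / K₁ - η := by
    have hrc := hr.continuous.continuousAt (x := p)
    have hc : ContinuousAt (fun z =>
        (-r z * (D * C ^ 2) + (-r z) ^ 2 * |K|) * (C * ‖n‖ / m) ^ 2) p := by fun_prop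
    refine hc.eventually (gt_mem_nhds ?_)
    simpa [hr.eq_zero_of_mem_frontier hp] using hη
  filter_upwards [hOka.eventually_le hr hp, hpinch, hC2r, hCz, hQle, hLge, hsmall,
    chart_source_mem_nhds E p] with z hoka hpin hzr hTz hQz hLz hsz hsrc hzΩ
  have ht : 0 < -r z := neg_pos.2 (hr.neg z hzΩ)
  have : FiniteDimensional ℝ (TangentSpace 𝓘(ℝ, E) z) := inferInstanceAs (FiniteDimensional ℝ E)
  set T : TangentSpace 𝓘(ℝ, E) z →ₗ[ℝ] E :=
    (tangentCoordChange 𝓘(ℝ, E) z p z : E →ₗ[ℝ] E) with hT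
  set q : TangentSpace 𝓘(ℝ, E) z →ₗ[ℝ] TangentSpace 𝓘(ℝ, E) z →ₗ[ℝ] ℝ :=
    LinearMap.mk₂ ℝ (fun ξ ζ => hessianForm R (chartAt E p z) (T ξ) (T ζ))
      (by simp) (by simp) (by simp) (by simp) with hq
  set L : TangentSpace 𝓘(ℝ, E) z →ₗ[ℝ] ℂ :=
    (delMap R (chartAt E p z) : E →ₗ[ℝ] ℂ).comp T with hL
  have hqe : ∀ ξ, cplxHessian r z ξ = q ξ ξ := fun ξ => cplxHessian_eq_in_chart hsrc hzr ξ
  have hLe : ∀ ξ, delForm r z ξ = L ξ := fun ξ => delForm_eq_in_chart hsrc hzr ξ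
  have hTle : ∀ ξ, ‖T ξ‖ ≤ C * ‖ξ‖ := hTz.1
  have hTsurj : ∀ w : E, ∃ ζ, T ζ = w ∧ ‖ζ‖ ≤ C * ‖w‖ := hTz.2
  have key := nonneg_of_oka_of_pinching (q := q) (L := L) (K := K) (K₁ := K₁) (t := -r z)
    (η := η) (C := C * ‖n‖ / m) (D := D * C ^ 2) hK₁ ht
    (fun ξ => by rw [← hqe, ← hLe]; exact hoka hzΩ ξ)
    (fun ξ hξ => by
      rw [← hLe] at hξ
      have h := hpin hzΩ ξ hξ
      rw [div_le_iff₀ ht, sqLength_eq_norm_sq] at h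
      rw [← hqe]
      linarith)
    (fun ξ => by
      have hnz : delMap R (chartAt E p z) n ≠ 0 := norm_pos_iff.1 (hm0.trans hLz)
      obtain ⟨ζ, hζ, hζle⟩ := hTsurj ((L ξ / delMap R (chartAt E p z) n) • n)
      refine ⟨ζ, ?_, hζle.trans ?_⟩
      · change delMap R (chartAt E p z) (T ζ) = _
        rw [hζ, delMap_complex_smul, div_mul_cancel₀ _ hnz]
      · rw [norm_smul, norm_div]
        calc C * (‖L ξ‖ / ‖delMap R (chartAt E p z) n‖ * ‖n‖) ≤ C * (‖L ξ‖ / m * ‖n‖) := by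
              gcongr
          _ = C * ‖n‖ / m * ‖L ξ‖ := by ring)
    (fun ξ => by
      calc |q ξ ξ| ≤ ‖hessianForm R (chartAt E p z)‖ * ‖T ξ‖ * ‖T ξ‖ :=
            (hessianForm R (chartAt E p z)).le_opNorm₂ (T ξ) (T ξ)
        _ ≤ D * (C * ‖ξ‖) * (C * ‖ξ‖) := by
            gcongr
            exacts [hTle ξ, hTle ξ]
        _ = D * C ^ 2 * ‖ξ‖ ^ 2 := by ring)
    (by positivity) hsz.le
  intro ξ
  rw [hqe, hLe]
  exact key ξ

end BoundaryPoint

/-! ### The index -/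

section Index

variable {E : Type*} [NormedAddCommGroup E] [NormedSpace ℂ E]
  {M : Type*} [EMetricSpace M] [ChartedSpace E M]

lemma dfIndexOf_le_one (Ω : Set M) (r : M → ℝ) : dfIndexOf E Ω r ≤ 1 :=
  Real.sSup_le (fun _ h => h.2.1) zero_le_one

lemma IsDefiningFunction.dfIndexOf_le_dfIndex {Ω : Set M} {r : M → ℝ}
    (hr : IsDefiningFunction E Ω r) : dfIndexOf E Ω r ≤ dfIndex E Ω := by
  refine le_csSup ⟨1, ?_⟩ ⟨r, hr, rfl⟩
  rintro _ ⟨r', -, rfl⟩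
  exact dfIndexOf_le_one Ω r'

end Index

theorem proposition2p3 {E : Type*} [NormedAddCommGroup E] [NormedSpace ℂ E]
    [FiniteDimensional ℂ E] {M : Type*} [EMetricSpace M] [ChartedSpace E M]
    [IsManifold 𝓘(ℂ, E) ω M]
    [RiemannianBundle (fun x : M => TangentSpace 𝓘(ℝ, E) x)]
    [IsContMDiffRiemannianBundle 𝓘(ℝ, E) ∞ E (fun x : M => TangentSpace 𝓘(ℝ, E) x)]
    [IsRiemannianManifold 𝓘(ℝ, E) M]
    (hHerm : IsHermitianMetric E M)
    (Ω : Set M) (hopen : IsOpen Ω) (hconn : IsConnected Ω) (hcpt : IsCompact (closure Ω))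
    (hC2 : HasC2Boundary E Ω)
    (r : M → ℝ) (hr : IsNormalizedDefiningFunction E Ω r)
    (K : ℝ) (hOka : OkaCondition E Ω r K)
    (V : Set M) (hV : V ∈ 𝓝ˢ (weaklyPseudoconvexPoints E Ω r))
    (K₁ : ℝ) (hK₁ : 1 < K₁)
    (hpinch : ∀ z ∈ V ∩ Ω, ∀ ξ : TangentSpace 𝓘(ℝ, E) z, delForm r z ξ = 0 →
      K * sqLength z ξ ≤ cplxHessian r z ξ / (-r z) ∧
      cplxHessian r z ξ / (-r z) ≤ K * K₁ * sqLength z ξ) :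
    max (min (1 / (8 * (K₁ - 1))) (1 / 2)) (3 - 2 * K₁) ≤ dfIndex E Ω := by
  have hK₀ : 0 < K₁ := by linarith
  have hinv : 1 / K₁ < 1 := (div_lt_one hK₀).2 hK₁
  have hexp : ∀ η, 0 < η → η < 1 / K₁ → IsDFExponent E Ω r η := by
    refine fun η h0 hη => ⟨h0, (hη.trans hinv).le, eventually_nhdsSet_iff_forall.2 fun p hp => ?_⟩
    have hloc : ∀ᶠ z in 𝓝 p, z ∈ Ω → ∀ ξ : TangentSpace 𝓘(ℝ, E) z,
        0 ≤ -r z * cplxHessian r z ξ + (1 - η) * ‖delForm r z ξ‖ ^ 2 := by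
      by_cases hpW : p ∈ weaklyPseudoconvexPoints E Ω r
      · refine eventually_nonneg_of_pinching hopen hC2 hOka hr.1 hp hK₁ hη ?_
        filter_upwards [mem_nhdsSet_iff_forall.1 hV p hpW] with z hzV hzΩ ξ hξ
        exact (hpinch z ⟨hzV, hzΩ⟩ ξ hξ).2
      · refine eventually_nonneg_of_pos hr.1 hp (hη.trans hinv) fun w hw0 hw => ?_
        have hnn : ∀ v : E, delMap (chartRep r p) (chartAt E p p) v = 0 →
            0 ≤ hessianForm (chartRep r p) (chartAt E p p) v v := fun v hv =>
          hOka.hessianForm_nonneg hopen hC2 hr.1 hp hv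
        refine (hnn w hw).lt_of_ne fun h => hpW ⟨hp, fun ξ hξ => ?_, w, hw0, ?_, ?_⟩
        · rw [delForm_eq_delMap] at hξ
          rw [cplxHessian_eq_hessianForm]
          exact hnn ξ hξ
        · exact (delForm_eq_delMap r p w).trans hw
        · exact (cplxHessian_eq_hessianForm r p w).trans h.symm
    filter_upwards [hloc, eventually_nhdsSet_iff_forall.1 hr.1.contMDiffAt p hp]
      with z hz hzr hzΩ ξ
    rw [cplxHessian_neg_rpow_neg hzr (hr.1.neg z hzΩ)]
    have ht : 0 < -r z := neg_pos.2 (hr.1.neg z hzΩ)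
    exact mul_nonneg (by positivity) (hz hzΩ ξ)
  have hindex : 1 / K₁ ≤ dfIndexOf E Ω r := by
    refine le_of_forall_lt fun c hc => ?_
    obtain ⟨η, hη, hη'⟩ := exists_between (max_lt hc (show (0 : ℝ) < 1 / K₁ by positivity))
    exact ((le_max_left _ _).trans_lt hη).trans_le
      (le_csSup ⟨1, fun _ h => h.2.1⟩ (hexp η ((le_max_right _ _).trans_lt hη) hη'))
  refine le_trans ?_ (hindex.trans hr.1.dfIndexOf_le_dfIndex)
  refine max_le ?_ ?_
  · rcases le_total K₁ 2 with h | h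
    · exact (min_le_right _ _).trans (one_div_le_one_div_of_le hK₀ h)
    · exact (min_le_left _ _).trans (one_div_le_one_div_of_le hK₀ (by linarith))
  · rw [le_div_iff₀ hK₀]
    nlinarith [sq_nonneg (K₁ - 1)]
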